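/- Let $U\subset\mathbb R^n$ be open and $f\in C^2(U\times\mathbb R,\mathbb R^n)$. Let $\Lambda\in C^2(\mathbb R,(\lambda_-,\lambda_+))$ satisfy $\Lambda(s)\to\lambda_\pm$ and $\Lambda'(s)\to0$ as $s\to\pm\infty$. An equilibrium $p\in U$ of $\dot x=f(x,\lambda)$ is called attracting if it is Lyapunov stable and its basin $\mathbb B(p,\lambda)$ (the set of all initial values in $U$ whose solution stays in $U$ for all $t\ge0$ and converges to $p$) is a neighbourhood of $p$. Let $(X(s),\Lambda(s))$ be a stable path: for every $s\in\mathbb R$, $X(s)$ is an attracting equilibrium of $\dot x=f(x,\Lambda(s))$, the limits $X_\pm=\lim_{s\to\pm\infty}X(s)$ exist, and $X_\pm$ are attracting equilibria of $\dot x=f(x,\lambda_\pm)$. Suppose that the path is forward inflowing stable, that is, there are compact sets $K(s)\subset\mathbb R^n$, $s\in\mathbb R$, such that 1. $X(s)\in\operatorname{Int}K(s)$ for all $s$; 2. $K(s_1)\subset K(s_2)$ whenever $s_1<s_2$; 3. for all $s$ and all $x\in\partial K(s)$ the vector $f(x,\Lambda(s))$ points strictly into $K(s)$, i.e. $x+h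 f(x,\Lambda(s))\in\operatorname{Int}K(s)$ for all sufficiently small $h>0$; 4. $X_\pm\in\operatorname{Int}K_\pm$, where $K_-=\bigcap_sK(s)$ and $K_+=\overline{\bigcup_sK(s)}$; 5. $K_+$ is compact and $K_+\subset\mathbb B(X_+,\lambda_+)$. For $r>0$, a pullback attractor to $X_-$ is a solution $x^r$ of $\dot x=f(x,\Lambda(rt))$ in $U$ with $x^r(t)\to X_-$ as $t\to-\infty$, defined on its maximal interval of existence $(-\infty,b)$, $b\le\infty$. Then for every $r>0$ a pullback attractor to $X_-$ exists, and every pullback attractor $x^r$ to $X_-$ endpoint tracks the path: it is defined for all $t\in\mathbb R$ and $x^r(t)\to X_+$ as $t\to\infty$. Moreover, the pullback attractor is unique if all eigenvalues of $\partial_xf(X_-,\lambda_-)$ have negative real part. In particular, there is no R-tipping away from $X_-$: there is no $r>0$ for which a pullback attractor to $X_-$ fails to endpoint track the path. -/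

import Mathlib

open Set Filter Topology

/-- A parameter shift from `lm` to `lp`: a `C²` function with values in the open interval
`(lm, lp)`, with limits `lm`, `lp` and with derivative tending to `0` at `∓∞`. -/
structure IsParameterShift (Λ : ℝ → ℝ) (lm lp : ℝ) : Prop where
  contDiff : ContDiff ℝ 2 Λ
  mem_Ioo : ∀ s, Λ s ∈ Ioo lm lp
  tendsto_atBot : Tendsto Λ atBot (𝓝 lm)
  tendsto_atTop : Tendsto Λ atTop (𝓝 lp)
  deriv_atBot : Tendsto (deriv Λ) atBot (𝓝 0)
  deriv_atTop : Tendsto (deriv Λ) atTop (𝓝 0)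

/-- `x` is a solution of `x' = g x` in `U`, defined for all times `t ≥ 0`. -/
def IsForwardSolution {E : Type*} [NormedAddCommGroup E] [NormedSpace ℝ E]
    (g : E → E) (U : Set E) (x : ℝ → E) : Prop :=
  ∀ t, 0 ≤ t → x t ∈ U ∧ HasDerivWithinAt x (g (x t)) (Ici 0) t

/-- The basin of attraction of `p` for the system `x' = g x` in `U`: the initial values whose
solution exists in `U` for all `t ≥ 0` and converges to `p`. -/
def basin {E : Type*} [NormedAddCommGroup E] [NormedSpace ℝ E]
    (g : E → E) (U : Set E) (p : E) : Set E :=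
  {y | ∃ x : ℝ → E, x 0 = y ∧ IsForwardSolution g U x ∧ Tendsto x atTop (𝓝 p)}

/-- `p` is an attracting equilibrium of `x' = g x` in `U`: an equilibrium that is Lyapunov stable
and whose basin of attraction is a neighbourhood of it. -/
structure IsAttractingEquilibrium {E : Type*} [NormedAddCommGroup E] [NormedSpace ℝ E]
    (g : E → E) (U : Set E) (p : E) : Prop where
  mem : p ∈ U
  eq_zero : g p = 0
  stable : ∀ ε > 0, ∃ δ > 0, ∀ x : ℝ → E, IsForwardSolution g U x → dist (x 0) p < δ →
    ∀ t, 0 ≤ t → dist (x t) p < ε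
  attracting : basin g U p ∈ 𝓝 p

/-- All (complex) eigenvalues of the derivative of `g` at `p` have negative real part. -/
def IsLinearlyStable {n : ℕ} (g : EuclideanSpace ℝ (Fin n) → EuclideanSpace ℝ (Fin n))
    (p : EuclideanSpace ℝ (Fin n)) : Prop :=
  ∀ μ : ℂ, Polynomial.aeval μ
    (LinearMap.charpoly
      (fderiv ℝ g p : EuclideanSpace ℝ (Fin n) →ₗ[ℝ] EuclideanSpace ℝ (Fin n))) = 0 →
    μ.re < 0

/-- `(X(s), Λ(s))` is a stable path of `x' = f(x, λ)` in `U` with limits `Xm`, `Xp`: for every `s`,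
and also in the limits `s → ∓∞`, it consists of attracting equilibria. -/
structure IsStablePath {E : Type*} [NormedAddCommGroup E] [NormedSpace ℝ E]
    (f : E → ℝ → E) (U : Set E) (Λ : ℝ → ℝ) (lm lp : ℝ) (X : ℝ → E) (Xm Xp : E) : Prop where
  attracting : ∀ s, IsAttractingEquilibrium (fun x => f x (Λ s)) U (X s)
  tendsto_atBot : Tendsto X atBot (𝓝 Xm)
  tendsto_atTop : Tendsto X atTop (𝓝 Xp)
  attracting_minus : IsAttractingEquilibrium (fun x => f x lm) U Xm
  attracting_plus : IsAttractingEquilibrium (fun x => f x lp) U Xp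

/-- The vector `v`, attached at `x`, points strictly into `K`: moving from `x` a short time in the
direction `v` leads into the interior of `K`. -/
def PointsStrictlyInto {E : Type*} [NormedAddCommGroup E] [NormedSpace ℝ E]
    (v x : E) (K : Set E) : Prop :=
  ∃ ε > 0, ∀ h : ℝ, 0 < h → h < ε → x + h • v ∈ interior K

/-- Forward inflowing stability of the path `(X(s), Λ(s))` with limits `Xm`, `Xp`. -/
def IsForwardInflowingStable {E : Type*} [NormedAddCommGroup E] [NormedSpace ℝ E]
    (f : E → ℝ → E) (U : Set E) (Λ : ℝ → ℝ) (lp : ℝ) (X : ℝ → E) (Xm Xp : E) : Prop :=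
  ∃ K : ℝ → Set E,
    (∀ s, IsCompact (K s)) ∧
    (∀ s, X s ∈ interior (K s)) ∧
    (∀ s₁ s₂, s₁ < s₂ → K s₁ ⊆ K s₂) ∧
    (∀ s, ∀ x ∈ frontier (K s), PointsStrictlyInto (f x (Λ s)) x (K s)) ∧
    Xm ∈ interior (⋂ s, K s) ∧
    Xp ∈ interior (closure (⋃ s, K s)) ∧
    IsCompact (closure (⋃ s, K s)) ∧
    closure (⋃ s, K s) ⊆ basin (fun x => f x lp) U Xp

/-- `x` solves `x' = f(x, Λ(r t))` in `U` on the time interval `(-∞, b)`, `b ≤ ∞`, and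
`x(t) → Xm` as `t → -∞`. Values of `x` outside `(-∞, b)` are irrelevant. -/
structure IsPullbackSolution {E : Type*} [NormedAddCommGroup E] [NormedSpace ℝ E]
    (f : E → ℝ → E) (U : Set E) (Λ : ℝ → ℝ) (r : ℝ) (Xm : E) (b : EReal) (x : ℝ → E) : Prop where
  bot_lt : ⊥ < b
  solution : ∀ t : ℝ, (t : EReal) < b → x t ∈ U ∧ HasDerivAt x (f (x t) (Λ (r * t))) t
  tendsto_atBot : Tendsto x atBot (𝓝 Xm)

/-- `x`, on `(-∞, b)`, is a (local) pullback attractor to `Xm` for the rate `r`: a trajectory that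
converges to `Xm` as `t → -∞`, on its maximal interval of existence. -/
structure IsPullbackAttractor {E : Type*} [NormedAddCommGroup E] [NormedSpace ℝ E]
    (f : E → ℝ → E) (U : Set E) (Λ : ℝ → ℝ) (r : ℝ) (Xm : E) (b : EReal) (x : ℝ → E) : Prop
    extends IsPullbackSolution f U Λ r Xm b x where
  maximal : ∀ (b' : EReal) (y : ℝ → E), IsPullbackSolution f U Λ r Xm b' y →
    (∀ t : ℝ, (t : EReal) < b → (t : EReal) < b' → y t = x t) → b' ≤ b

/-- The trajectory `x` on `(-∞, b)` endpoint tracks a path with limit `Xp` at `+∞`: it exists for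
all times and converges to `Xp`. -/
def EndpointTracks {E : Type*} [TopologicalSpace E] (Xp : E) (b : EReal) (x : ℝ → E) : Prop :=
  b = ⊤ ∧ Tendsto x atTop (𝓝 Xp)

/-- There is R-tipping away from `Xm`: for some rate `r > 0` a pullback attractor to `Xm` does not
endpoint track the path. -/
def HasRTipping {E : Type*} [NormedAddCommGroup E] [NormedSpace ℝ E]
    (f : E → ℝ → E) (U : Set E) (Λ : ℝ → ℝ) (Xm Xp : E) : Prop :=
  ∃ r : ℝ, r > 0 ∧ ∃ (b : EReal) (x : ℝ → E), IsPullbackAttractor f U Λ r Xm b x ∧ ¬ EndpointTracks Xp b x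

/-!
Cutting `f` off outside a neighbourhood of the compact set `K₊ = closure (⋃ s, K s)` replaces it by
bounded, globally Lipschitz fields, for which every initial value problem has exactly one solution
and that solution exists for all times. By a Nagumo-type argument the sets `K (r * t)` are forward
invariant, so a solution coming from `X₋` never leaves `⋃ s, K s`; there the cut-off is not felt,
and the solution is global.

At `+∞` the equation converges to the autonomous limit equation, whose attractor `X₊` attracts the
compact set `K₊` uniformly; hence solutions staying in `K₊` converge to `X₊`. At `-∞`, stability of
`X₋` for the limit equation traps the solutions started at `X₋` at times `-n` near `X₋`, and a limit
point of this sequence is a pullback attractor. If the linearization at `X₋` is Hurwitz, the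
difference of two pullback attractors solves a small perturbation of a contracting linear equation
and is bounded on a left half-line, which forces it to vanish there.
-/

section WellPosed

variable {E : Type*} [NormedAddCommGroup E] [NormedSpace ℝ E] {v : ℝ → E → E} {K : NNReal}
  {y z : ℝ → E}

/-- A time-dependent vector field on the whole space that is `K`-Lipschitz in space, continuous in
time and bounded. These are the fields whose integral curves exist for all times; an autonomous
field `g` is treated as `fun _ => g`. -/
structure IsBoundedLipschitzField (v : ℝ → E → E) (K : NNReal) : Prop where
  lipschitz : ∀ t, LipschitzWith K (v t)
  continuous : ∀ x, Continuous fun t => v t x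
  bounded : ∃ C : NNReal, ∀ t x, ‖v t x‖ ≤ C

lemma eq_of_isIntegralCurve_of_eq (hv : ∀ t, LipschitzWith K (v t)) (hy : IsIntegralCurve y v)
    (hz : IsIntegralCurve z v) {a : ℝ} (h : y a = z a) : y = z :=
  ODE_solution_unique_univ (s := fun _ => univ) (fun t => (hv t).lipschitzOnWith)
    (fun t => ⟨hy t, mem_univ _⟩) (fun t => ⟨hz t, mem_univ _⟩) h

lemma IsBoundedLipschitzField.exists_hasDerivAt_Ioo [CompleteSpace E]
    (hv : IsBoundedLipschitzField v K) (a : ℝ) (x₀ : E) {R : ℝ} (hR : 0 < R) :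
    ∃ y : ℝ → E, y a = x₀ ∧ ∀ t ∈ Ioo (a - R) (a + R), HasDerivAt y (v t (y t)) t := by
  obtain ⟨C, hC⟩ := hv.bounded
  have hPL : IsPicardLindelof v (tmin := a - R) (tmax := a + R)
      ⟨a, by constructor <;> linarith⟩ x₀ (C * R.toNNReal) 0 C K :=
    { lipschitzOnWith := fun t _ => (hv.lipschitz t).lipschitzOnWith
      continuousOn := fun x _ => (hv.continuous x).continuousOn
      norm_le := fun t _ x _ => hC t x
      mul_max_le := by simp [hR.le] }
  obtain ⟨y, hya, hy⟩ := hPL.exists_eq_forall_mem_Icc_hasDerivWithinAt₀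
  exact ⟨y, hya, fun t ht => (hy t (Ioo_subset_Icc_self ht)).hasDerivAt (Icc_mem_nhds ht.1 ht.2)⟩

lemma IsBoundedLipschitzField.exists_isIntegralCurve [CompleteSpace E]
    (hv : IsBoundedLipschitzField v K) (a : ℝ) (x₀ : E) :
    ∃ y : ℝ → E, y a = x₀ ∧ IsIntegralCurve y v := by
  have hpos (n : ℕ) : (0 : ℝ) < n + 1 := n.cast_add_one_pos
  choose α hαa hα using fun n : ℕ => hv.exists_hasDerivAt_Ioo a x₀ (hpos n)
  have heq {n m : ℕ} (hnm : n ≤ m) : EqOn (α n) (α m) (Ioo (a - (n + 1)) (a + (n + 1))) := by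
    have hsub : Ioo (a - (n + 1 : ℝ)) (a + (n + 1)) ⊆ Ioo (a - (m + 1)) (a + (m + 1)) := by
      have : (n : ℝ) ≤ m := mod_cast hnm
      apply Ioo_subset_Ioo <;> linarith
    exact ODE_solution_unique_of_mem_Ioo (s := fun _ => univ) (t₀ := a)
      (fun t _ => (hv.lipschitz t).lipschitzOnWith) (by simp [hpos n])
      (fun t ht => ⟨hα n t ht, mem_univ _⟩) (fun t ht => ⟨hα m t (hsub ht), mem_univ _⟩)
      ((hαa n).trans (hαa m).symm)
  let N (t : ℝ) : ℕ := ⌈|t - a|⌉₊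
  have hmem (t : ℝ) : t ∈ Ioo (a - (N t + 1)) (a + (N t + 1)) := by
    have := abs_le.1 (Nat.le_ceil |t - a|)
    constructor <;> linarith
  refine ⟨fun t => α (N t) t, hαa _, fun t => (hα _ t (hmem t)).congr_of_eventuallyEq ?_⟩
  filter_upwards [isOpen_Ioo.mem_nhds (hmem t)] with s hs
  rcases le_total (N s) (N t) with h | h
  · exact heq h (hmem s)
  · exact (heq h hs).symm

lemma dist_le_mul_exp_of_isIntegralCurve_of_le (hv : ∀ t, LipschitzWith K (v t))
    (hy : IsIntegralCurve y v) (hz : IsIntegralCurve z v) {s t : ℝ} (h : s ≤ t) :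
    dist (y t) (z t) ≤ dist (y s) (z s) * Real.exp (K * (t - s)) :=
  dist_le_of_trajectories_ODE hv hy.continuous.continuousOn (fun t _ => (hy t).hasDerivWithinAt)
    hz.continuous.continuousOn (fun t _ => (hz t).hasDerivWithinAt) le_rfl t ⟨h, le_rfl⟩

lemma isIntegralCurve_comp_neg (hy : IsIntegralCurve y v) :
    IsIntegralCurve (fun t => y (-t)) fun t x => -v (-t) x := fun t => by
  simpa [Function.comp_def] using (hy (-t)).scomp t (hasDerivAt_neg t)

lemma dist_le_mul_exp_abs_of_isIntegralCurve (hv : ∀ t, LipschitzWith K (v t))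
    (hy : IsIntegralCurve y v) (hz : IsIntegralCurve z v) (s t : ℝ) :
    dist (y t) (z t) ≤ dist (y s) (z s) * Real.exp (K * |t - s|) := by
  rcases le_total s t with h | h
  · rw [abs_of_nonneg (sub_nonneg.2 h)]
    exact dist_le_mul_exp_of_isIntegralCurve_of_le hv hy hz h
  · rw [abs_sub_comm, abs_of_nonneg (sub_nonneg.2 h)]
    simpa [neg_add_eq_sub] using dist_le_mul_exp_of_isIntegralCurve_of_le
      (fun t => (hv (-t)).neg) (isIntegralCurve_comp_neg hy) (isIntegralCurve_comp_neg hz)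
      (neg_le_neg h)

end WellPosed

section Comparison

variable {E : Type*} [NormedAddCommGroup E] [NormedSpace ℝ E]

lemma gronwallBound_mul_left (c δ K ε x : ℝ) :
    gronwallBound (c * δ) K (c * ε) x = c * gronwallBound δ K ε x := by
  rcases eq_or_ne K 0 with rfl | hK
  · simp only [gronwallBound_K0]
    ring
  · simp only [gronwallBound_of_K_ne_0 hK]
    ring

lemma exists_forall_dist_le_mul_of_dist_deriv_le (K : NNReal) {T : ℝ} (hT : 0 ≤ T) {ε : ℝ}
    (hε : 0 < ε) :
    ∃ η > 0, ∀ {v : ℝ → E → E} {y y' z : ℝ → E} {a b M : ℝ}, (∀ t, LipschitzWith K (v t)) →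
      0 ≤ M → b ∈ Icc a (a + T) → (∀ t ∈ Icc a b, HasDerivAt y (y' t) t) →
      (∀ t ∈ Icc a b, dist (y' t) (v t (y t)) ≤ η * M) → IsIntegralCurve z v →
      dist (y a) (z a) ≤ η * M → dist (y b) (z b) ≤ ε * M := by
  have hmono : Monotone (gronwallBound 1 K 1) := gronwallBound_mono zero_le_one zero_le_one K.2
  have hG : 0 < gronwallBound 1 K 1 T :=
    zero_lt_one.trans_le ((gronwallBound_x0 1 K 1).symm.trans_le (hmono hT))
  refine ⟨ε / gronwallBound 1 K 1 T, by positivity,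
    fun {v y y' z a b M} hv hM hb hy hyv hz ha => ?_⟩
  set η := ε / gronwallBound 1 K 1 T
  calc dist (y b) (z b)
      ≤ gronwallBound (η * M) K (η * M + 0) (b - a) :=
        dist_le_of_approx_trajectories_ODE hv (HasDerivAt.continuousOn hy)
          (fun t ht => (hy t (Ico_subset_Icc_self ht)).hasDerivWithinAt)
          (fun t ht => hyv t (Ico_subset_Icc_self ht)) hz.continuous.continuousOn
          (fun t _ => (hz t).hasDerivWithinAt) (fun t _ => (dist_self _).le) ha b ⟨hb.1, le_rfl⟩
    _ = η * M * gronwallBound 1 K 1 (b - a) := by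
        simpa using gronwallBound_mul_left (η * M) 1 K 1 (b - a)
    _ ≤ η * M * gronwallBound 1 K 1 T := by
        have : b - a ≤ T := by linarith [hb.2]
        gcongr
        exact hmono this
    _ = ε * M := by
        simp only [η]
        field_simp

lemma exists_forall_dist_le_of_field_dist_le (K : NNReal) {T : ℝ} (hT : 0 ≤ T) {ε : ℝ}
    (hε : 0 < ε) :
    ∃ η > 0, ∀ {v w : ℝ → E → E} {y z : ℝ → E} {a b : ℝ}, (∀ t, LipschitzWith K (w t)) →
      b ∈ Icc a (a + T) → IsIntegralCurve y v → IsIntegralCurve z w →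
      (∀ t ∈ Icc a b, ∀ x, dist (v t x) (w t x) ≤ η) → dist (y a) (z a) ≤ η →
      dist (y b) (z b) ≤ ε := by
  obtain ⟨η, hη, h⟩ := exists_forall_dist_le_mul_of_dist_deriv_le (E := E) K hT hε
  exact ⟨η, hη, fun hw hb hy hz hvw ha => by
    simpa using h (M := 1) hw zero_le_one hb (fun t _ => hy t)
      (fun t ht => by simpa using hvw t ht _) hz (by simpa using ha)⟩

end Comparison

section Viability

variable {E : Type*} [NormedAddCommGroup E] [NormedSpace ℝ E] {v : ℝ → E → E} {C : ℝ → Set E}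

/-- A family of closed sets, growing in time, such that at each time `t` and each point of `C t`
the field `v t` points into `C t` for a short while. It is the time-dependent trapping region of
forward inflowing stability, with the weak form of the inward condition that viability needs. -/
structure IsInflowingFamily (v : ℝ → E → E) (C : ℝ → Set E) : Prop where
  isClosed : ∀ t, IsClosed (C t)
  mono : Monotone C
  inward : ∀ t, ∀ x ∈ C t, ∀ᶠ h in 𝓝[>] (0 : ℝ), x + h • v t x ∈ C t

lemma forall_mem_Icc_of_eventually_nhdsGT {α : Type*} [ConditionallyCompleteLinearOrder α]
    [TopologicalSpace α] [OrderTopology α] [DenselyOrdered α] [NoMaxOrder α] {a b : α}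
    {P : α → Prop} (ha : P a)
    (hleft : ∀ t ∈ Ioc a b, (∀ s ∈ Ico a t, P s) → P t)
    (hright : ∀ t ∈ Ico a b, P t → ∀ᶠ s in 𝓝[>] t, P s) {t : α} (ht : t ∈ Icc a b) : P t := by
  let S : Set α := {t | ∀ s ∈ Icc a t, P s}
  suffices hS : Icc a b ⊆ S from hS ht t ⟨ht.1, le_rfl⟩
  refine IsClosed.Icc_subset_of_forall_exists_gt ?_ ?_ ?_
  · refine isClosed_of_closure_subset fun t ht => ?_
    have htab : t ∈ Icc a b := closure_minimal inter_subset_right isClosed_Icc ht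
    have hlt : ∀ s ∈ Ico a t, P s := fun s hs => by
      obtain ⟨u, hsu, huS, -⟩ := mem_closure_iff.1 ht (Ioi s) isOpen_Ioi hs.2
      exact huS s ⟨hs.1, le_of_lt hsu⟩
    refine ⟨fun s hs => ?_, htab⟩
    rcases hs.2.lt_or_eq with hst | rfl
    · exact hlt s ⟨hs.1, hst⟩
    rcases hs.1.eq_or_lt with rfl | has
    · exact ha
    · exact hleft s ⟨has, htab.2⟩ hlt
  · exact fun s hs => (le_antisymm hs.2 hs.1 : s = a) ▸ ha
  · rintro t ⟨htS, ht⟩ u (hu : t < u)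
    obtain ⟨c, hc, hcP⟩ := (mem_nhdsGT_iff_exists_Ioc_subset).1
      (hright t ht (htS t ⟨ht.1, le_rfl⟩))
    refine ⟨min c u, fun s hs => ?_, lt_min hc hu, min_le_right _ _⟩
    rcases le_or_gt s t with h | h
    · exact htS s ⟨hs.1, h⟩
    · exact hcP ⟨h, hs.2.trans (min_le_left _ _)⟩

lemma IsInflowingFamily.eventually_add_smul_mem (hC : IsInflowingFamily v C) {t : ℝ} {x : E}
    (hx : x ∈ C t) : ∀ᶠ s in 𝓝[>] t, x + (s - t) • v t x ∈ C t := by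
  have hsub : Tendsto (fun s => s - t) (𝓝[>] t) (𝓝[>] 0) := by
    refine tendsto_nhdsWithin_iff.2 ⟨?_, ?_⟩
    · exact ((continuous_sub_right t).tendsto' t 0 (sub_self t)).mono_left nhdsWithin_le_nhds
    · filter_upwards [self_mem_nhdsWithin] with s (hs : t < s) using sub_pos.2 hs
  exact hsub.eventually (hC.inward t x hx)

variable [ProperSpace E] {K : NNReal} {y : ℝ → E}

lemma IsInflowingFamily.eventually_infDist_le (hC : IsInflowingFamily v C)
    {t : ℝ} (hv : LipschitzWith K (v t)) (hy : HasDerivAt y (v t (y t)) t) (hne : (C t).Nonempty)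
    {ρ : ℝ} (hρ : 0 < ρ) (hyρ : Metric.infDist (y t) (C t) ≤ ρ) :
    ∀ᶠ s in 𝓝[>] t, Metric.infDist (y s) (C s) ≤ ρ * Real.exp ((K + 1) * (s - t)) := by
  obtain ⟨p, hp, hyp⟩ := (hC.isClosed t).exists_infDist_eq_dist hne (y t)
  have hdist : dist (y t) p ≤ ρ := hyp.symm.trans_le hyρ
  have hvdist : ‖v t (y t) - v t p‖ ≤ K * ρ := by
    rw [← dist_eq_norm]
    exact (hv.dist_le_mul _ _).trans (by gcongr)
  have hlin : ∀ᶠ s in 𝓝[>] t, ‖y s - y t - (s - t) • v t (y t)‖ ≤ ρ * ‖s - t‖ :=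
    ((hasDerivAt_iff_isLittleO.1 hy).def hρ).filter_mono nhdsWithin_le_nhds
  filter_upwards [hC.eventually_add_smul_mem hp, hlin, self_mem_nhdsWithin]
    with s hpC hlin (hs : t < s)
  have hst : 0 < s - t := sub_pos.2 hs
  rw [Real.norm_of_nonneg hst.le] at hlin
  calc Metric.infDist (y s) (C s)
      ≤ dist (y s) (p + (s - t) • v t p) := Metric.infDist_le_dist_of_mem (hC.mono hs.le hpC)
    _ = ‖(y s - y t - (s - t) • v t (y t)) + (y t - p) + (s - t) • (v t (y t) - v t p)‖ := by
        rw [dist_eq_norm]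
        congr 1
        module
    _ ≤ ρ * (s - t) + ρ + (s - t) * (K * ρ) := by
        refine (norm_add₃_le ..).trans ?_
        rw [norm_smul, Real.norm_of_nonneg hst.le, ← dist_eq_norm (y t) p]
        gcongr
    _ = ρ * ((K + 1) * (s - t) + 1) := by ring
    _ ≤ ρ * Real.exp ((K + 1) * (s - t)) := by
        gcongr
        exact Real.add_one_le_exp _

lemma IsInflowingFamily.infDist_le (hC : IsInflowingFamily v C) (hv : ∀ t, LipschitzWith K (v t))
    (hy : IsIntegralCurve y v) {a b : ℝ} (ha : y a ∈ C a) {ρ : ℝ} (hρ : 0 < ρ) (hab : a ≤ b) :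
    Metric.infDist (y b) (C b) ≤ ρ * Real.exp ((K + 1) * (b - a)) := by
  have hne {t : ℝ} (ht : a ≤ t) : (C t).Nonempty := ⟨y a, hC.mono ht ha⟩
  refine forall_mem_Icc_of_eventually_nhdsGT (b := b)
    (P := fun t => Metric.infDist (y t) (C t) ≤ ρ * Real.exp ((K + 1) * (t - a)))
    ?_ (fun t ht hlt => ?_) (fun t ht hle => ?_) ⟨hab, le_rfl⟩
  · rw [Metric.infDist_zero_of_mem ha]
    positivity
  · have hyt : Tendsto (fun s => Metric.infDist (y s) (C t)) (𝓝[<] t)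
        (𝓝 (Metric.infDist (y t) (C t))) :=
      (((Metric.continuous_infDist_pt _).comp hy.continuous).tendsto t).mono_left
        nhdsWithin_le_nhds
    have hexp : Continuous fun s => ρ * Real.exp ((K + 1) * (s - a)) := by fun_prop
    refine le_of_tendsto_of_tendsto hyt ((hexp.tendsto t).mono_left nhdsWithin_le_nhds) ?_
    filter_upwards [Ioo_mem_nhdsLT ht.1] with s hs
    exact (Metric.infDist_le_infDist_of_subset (hC.mono hs.2.le) (hne hs.1.le)).trans
      (hlt s (Ioo_subset_Ico_self hs))
  · filter_upwards [hC.eventually_infDist_le (hv t) (hy t) (hne ht.1) (by positivity) hle] with s hs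
    rwa [mul_assoc, ← Real.exp_add, ← mul_add, sub_add_sub_cancel'] at hs

lemma IsInflowingFamily.mem_of_le (hC : IsInflowingFamily v C) (hv : ∀ t, LipschitzWith K (v t))
    (hy : IsIntegralCurve y v) {a b : ℝ} (ha : y a ∈ C a) (hab : a ≤ b) : y b ∈ C b := by
  refine ((hC.isClosed b).mem_iff_infDist_zero ⟨y a, hC.mono hab ha⟩).2
    (le_antisymm (le_of_forall_gt_imp_ge_of_dense fun δ hδ => ?_) Metric.infDist_nonneg)
  have h := hC.infDist_le hv hy ha (ρ := δ / Real.exp ((K + 1) * (b - a))) (by positivity) hab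
  rwa [div_mul_cancel₀ _ (Real.exp_pos _).ne'] at h

lemma IsInflowingFamily.mem_of_tendsto_atBot (hC : IsInflowingFamily v C)
    (hv : ∀ t, LipschitzWith K (v t)) (hy : IsIntegralCurve y v) {p : E}
    (hp : p ∈ interior (⋂ t, C t)) (hyp : Tendsto y atBot (𝓝 p)) (t : ℝ) : y t ∈ C t := by
  obtain ⟨a, ha, hat⟩ :=
    ((hyp.eventually (mem_interior_iff_mem_nhds.1 hp)).and (eventually_le_atBot t)).exists
  exact hC.mem_of_le hv hy (mem_iInter.1 ha a) hat

lemma IsInflowingFamily.mem_closure_iUnion (hC : IsInflowingFamily v C)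
    (hv : IsBoundedLipschitzField v K) {g : E → E} {L : NNReal} (hg : LipschitzWith L g)
    (hvg : TendstoUniformly v g atTop) (hy : IsIntegralCurve y fun _ => g)
    (h0 : y 0 ∈ closure (⋃ t, C t)) {t : ℝ} (ht : 0 ≤ t) : y t ∈ closure (⋃ t, C t) := by
  refine Metric.mem_closure_iff.2 fun ε hε => ?_
  obtain ⟨η, hη, hclose⟩ := exists_forall_dist_le_of_field_dist_le (E := E) L ht (half_pos hε)
  obtain ⟨q, hq, hqη⟩ := Metric.mem_closure_iff.1 h0 η hη
  obtain ⟨s, hqs⟩ := mem_iUnion.1 hq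
  obtain ⟨τ, hτ⟩ := eventually_atTop.1 (Metric.tendstoUniformly_iff.1 hvg η hη)
  obtain ⟨z, hzq, hz⟩ := hv.exists_isIntegralCurve (max s τ) q
  have hzC : z (max s τ + t) ∈ C (max s τ + t) :=
    hC.mem_of_le hv.lipschitz hz (hzq ▸ hC.mono (le_max_left s τ) hqs) (by linarith)
  have hdist : dist (z (max s τ + t)) (y t) ≤ ε / 2 := by
    have hshift : IsIntegralCurve (fun u => y (u - max s τ)) fun _ => g := hy.comp_sub (max s τ)
    simpa using hclose (a := max s τ) (fun _ => hg) ⟨by linarith, le_rfl⟩ hz hshift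
      (fun u hu x => by
        rw [dist_comm]
        exact (hτ u ((le_max_right s τ).trans hu.1) x).le)
      (by simpa [hzq, dist_comm] using hqη.le)
  refine ⟨_, mem_iUnion.2 ⟨_, hzC⟩, ?_⟩
  rw [dist_comm]
  linarith

end Viability

section AsymptoticallyAutonomous

variable {E : Type*} [NormedAddCommGroup E] [NormedSpace ℝ E] {v : ℝ → E → E} {g : E → E}
  {K L : NNReal} {p : E} {y : ℝ → E}

/-- Lyapunov stability of `p` for the autonomous field `g` on the whole space, in terms of complete
integral curves. -/
def IsLyapunovStable (g : E → E) (p : E) : Prop :=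
  ∀ ε > 0, ∃ δ > 0, ∀ y : ℝ → E, IsIntegralCurve y (fun _ => g) → dist (y 0) p < δ →
    ∀ t, 0 ≤ t → dist (y t) p < ε

/-- The flow of the autonomous field `g` contracts the set `P` to `p`, uniformly in the starting
point. -/
def AttractsUniformly (g : E → E) (p : E) (P : Set E) : Prop :=
  ∀ ε > 0, ∀ᶠ t in atTop, ∀ y : ℝ → E, IsIntegralCurve y (fun _ => g) → y 0 ∈ P →
    dist (y t) p < ε

/-- Asymptotic stability of `p` for the autonomous field `g`, with locally uniform attraction. -/
structure IsAsymptoticallyStable (g : E → E) (p : E) : Prop where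
  stable : IsLyapunovStable g p
  attracts : ∃ N ∈ 𝓝 p, AttractsUniformly g p N

lemma IsLyapunovStable.eventually_dist_lt (hg : LipschitzWith K g) (hstab : IsLyapunovStable g p)
    {z : ℝ → E} (hz : IsIntegralCurve z fun _ => g) (hzp : Tendsto z atTop (𝓝 p)) {ε : ℝ}
    (hε : 0 < ε) : ∃ N ∈ 𝓝 (z 0), ∀ᶠ t in atTop, ∀ y : ℝ → E, IsIntegralCurve y (fun _ => g) →
      y 0 ∈ N → dist (y t) p < ε := by
  obtain ⟨δ, hδ, hδε⟩ := hstab ε hε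
  obtain ⟨T, hTz, hT⟩ :=
    ((hzp.eventually (Metric.ball_mem_nhds p (half_pos hδ))).and (eventually_ge_atTop 0)).exists
  obtain ⟨η, hη, hclose⟩ := exists_forall_dist_le_of_field_dist_le (E := E) K hT (half_pos hδ)
  refine ⟨Metric.closedBall (z 0) η, Metric.closedBall_mem_nhds _ hη, ?_⟩
  filter_upwards [eventually_ge_atTop T] with t ht y hy h0
  have hyz : dist (y T) (z T) ≤ δ / 2 :=
    hclose (a := 0) (fun _ => hg) ⟨hT, by simp⟩ hy hz (fun _ _ _ => by simpa using hη.le) h0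
  have hyp : dist (y T) p < δ := by
    linarith [dist_triangle (y T) (z T) p, Metric.mem_ball.1 hTz]
  simpa using hδε _ (hy.comp_add T) (by simpa using hyp) (t - T) (sub_nonneg.2 ht)

lemma IsLyapunovStable.attractsUniformly_of_isCompact [CompleteSpace E]
    (hg : IsBoundedLipschitzField (fun _ => g) K) (hstab : IsLyapunovStable g p) {P : Set E}
    (hP : IsCompact P)
    (hatt : ∀ y : ℝ → E, IsIntegralCurve y (fun _ => g) → y 0 ∈ P → Tendsto y atTop (𝓝 p)) :
    AttractsUniformly g p P := fun ε hε => by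
  refine hP.induction_on (by simp)
    (fun S S' hS hS' => hS'.mono fun t ht y hy h0 => ht y hy (hS h0))
    (fun S S' hS hS' => ?_) fun x hx => ?_
  · filter_upwards [hS, hS'] with t ht ht' y hy h0 using h0.elim (ht y hy) (ht' y hy)
  · obtain ⟨z, rfl, hz⟩ := hg.exists_isIntegralCurve 0 x
    obtain ⟨N, hN, hNε⟩ :=
      hstab.eventually_dist_lt (hg.lipschitz 0) hz (hatt z hz hx) hε
    exact ⟨N, mem_nhdsWithin_of_mem_nhds hN, hNε⟩

lemma AttractsUniformly.tendsto_of_tendstoUniformly [CompleteSpace E]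
    (hg : IsBoundedLipschitzField (fun _ => g) K) (hvg : TendstoUniformly v g atTop) {P : Set E}
    (hP : AttractsUniformly g p P) (hy : IsIntegralCurve y v) (hyP : ∀ᶠ t in atTop, y t ∈ P) :
    Tendsto y atTop (𝓝 p) := by
  refine Metric.tendsto_nhds.2 fun ε hε => ?_
  obtain ⟨T, hTP, hT⟩ := ((hP (ε / 2) (half_pos hε)).and (eventually_ge_atTop 0)).exists
  obtain ⟨η, hη, hclose⟩ := exists_forall_dist_le_of_field_dist_le (E := E) K hT (half_pos hε)
  obtain ⟨τ, hτ⟩ := eventually_atTop.1 (hyP.and (Metric.tendstoUniformly_iff.1 hvg η hη))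
  filter_upwards [eventually_ge_atTop (τ + T)] with t ht
  obtain ⟨z, hz0, hz⟩ := hg.exists_isIntegralCurve (t - T) (y (t - T))
  have hyz : dist (y t) (z t) ≤ ε / 2 :=
    hclose (a := t - T) hg.lipschitz ⟨by linarith, by simp⟩ hy hz
      (fun s hs x => by
        rw [dist_comm]
        exact ((hτ s (by linarith [hs.1])).2 x).le)
      (by simpa [hz0] using hη.le)
  have hzp : dist (z t) p < ε / 2 := by
    simpa using hTP _ (hz.comp_add (t - T)) (by simpa [hz0] using (hτ (t - T) (by linarith)).1)
  linarith [dist_triangle (y t) (z t) p]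

lemma IsAsymptoticallyStable.exists_trapping_step [CompleteSpace E]
    (hg : IsBoundedLipschitzField (fun _ => g) K) (hp : IsAsymptoticallyStable g p)
    (hvg : TendstoUniformly v g atBot) {ε : ℝ} (hε : 0 < ε) :
    ∃ δ > 0, ∃ T > 0, ∃ τ : ℝ, ∀ y : ℝ → E, IsIntegralCurve y v → ∀ s, dist (y s) p ≤ δ →
      (∀ t ∈ Icc s (s + T), t ≤ τ → dist (y t) p ≤ ε) ∧ (s + T ≤ τ → dist (y (s + T)) p ≤ δ) := by
  obtain ⟨δ₁, hδ₁, hstab⟩ := hp.stable (ε / 2) (half_pos hε)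
  obtain ⟨N, hN, hatt⟩ := hp.attracts
  obtain ⟨δ, hδ, hδN⟩ := Metric.nhds_basis_closedBall.mem_iff.1
    (inter_mem hN (Metric.ball_mem_nhds p hδ₁))
  obtain ⟨T, hTN, hT⟩ := ((hatt (δ / 2) (half_pos hδ)).and (eventually_gt_atTop 0)).exists
  obtain ⟨η, hη, hclose⟩ := exists_forall_dist_le_of_field_dist_le (E := E) K hT.le
    (lt_min (half_pos hε) (half_pos hδ))
  obtain ⟨τ, hτ⟩ := eventually_atBot.1 (Metric.tendstoUniformly_iff.1 hvg η hη)
  refine ⟨δ, hδ, T, hT, τ, fun y hy s hs => ?_⟩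
  obtain ⟨z, hz0, hz⟩ := hg.exists_isIntegralCurve s (y s)
  have hyz : ∀ t ∈ Icc s (s + T), t ≤ τ → dist (y t) (z t) ≤ min (ε / 2) (δ / 2) :=
    fun t ht htτ => hclose (a := s) hg.lipschitz ht hy hz
      (fun u hu x => by
        rw [dist_comm]
        exact (hτ u (hu.2.trans htτ) x).le)
      (by simpa [hz0] using hη.le)
  have hzs : z (0 + s) ∈ N ∩ Metric.ball p δ₁ := hδN (by simpa [hz0] using hs)
  refine ⟨fun t ht htτ => ?_, fun hsτ => ?_⟩
  · have hzt : dist (z t) p < ε / 2 := by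
      simpa using hstab _ (hz.comp_add s) hzs.2 (t - s) (sub_nonneg.2 ht.1)
    linarith [dist_triangle (y t) (z t) p, (le_min_iff.1 (hyz t ht htτ)).1]
  · have hzT : dist (z (s + T)) p < δ / 2 := by
      simpa [add_comm T s] using hTN _ (hz.comp_add s) hzs.1
    linarith [dist_triangle (y (s + T)) (z (s + T)) p,
      (le_min_iff.1 (hyz (s + T) ⟨by linarith, le_rfl⟩ hsτ)).2]

lemma IsAsymptoticallyStable.exists_forall_dist_le_of_eq [CompleteSpace E]
    (hg : IsBoundedLipschitzField (fun _ => g) K) (hp : IsAsymptoticallyStable g p)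
    (hvg : TendstoUniformly v g atBot) {ε : ℝ} (hε : 0 < ε) :
    ∃ τ : ℝ, ∀ (y : ℝ → E) (a : ℝ), IsIntegralCurve y v → y a = p →
      ∀ t ∈ Icc a τ, dist (y t) p ≤ ε := by
  obtain ⟨δ, hδ, T, hT, τ, hstep⟩ := hp.exists_trapping_step hg hvg hε
  refine ⟨τ, fun y a hy ha t ht => ?_⟩
  have hiter (k : ℕ) :
      ∀ s, dist (y s) p ≤ δ → ∀ t ∈ Icc s (s + k * T), t ≤ τ → dist (y t) p ≤ ε := by
    induction k with
    | zero =>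
      exact fun s hs t ht => (hstep y hy s hs).1 t
        ⟨ht.1, ht.2.trans (by simpa using hT.le)⟩
    | succ k ih =>
      intro s hs t ht htτ
      push_cast at ht
      rcases le_total t (s + T) with h | h
      · exact (hstep y hy s hs).1 t ⟨ht.1, h⟩ htτ
      · exact ih (s + T) ((hstep y hy s hs).2 (h.trans htτ)) t ⟨h, by linarith [ht.2]⟩ htτ
  obtain ⟨k, hk⟩ := exists_nat_ge ((t - a) / T)
  exact hiter k a (by simpa [ha] using hδ.le) t
    ⟨ht.1, by linarith [(div_le_iff₀ hT).1 hk]⟩ ht.2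

lemma IsAsymptoticallyStable.exists_isIntegralCurve_tendsto_atBot [ProperSpace E]
    (hg : IsBoundedLipschitzField (fun _ => g) K) (hp : IsAsymptoticallyStable g p)
    (hv : IsBoundedLipschitzField v L) (hvg : TendstoUniformly v g atBot) :
    ∃ y : ℝ → E, IsIntegralCurve y v ∧ Tendsto y atBot (𝓝 p) := by
  have hnear (ε : ℝ) (hε : 0 < ε) := hp.exists_forall_dist_le_of_eq hg hvg hε
  choose u hup hu using fun n : ℕ => hv.exists_isIntegralCurve (-(n : ℝ)) p
  have hle (t : ℝ) : ∀ᶠ n : ℕ in atTop, -(n : ℝ) ≤ t :=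
    (tendsto_neg_atTop_atBot.comp tendsto_natCast_atTop_atTop).eventually_le_atBot t
  obtain ⟨τ, hτ⟩ := hnear 1 one_pos
  have hball : ∃ᶠ n in atTop, u n τ ∈ Metric.closedBall p 1 :=
    ((hle τ).mono fun n hn => hτ (u n) _ (hu n) (hup n) τ ⟨hn, le_rfl⟩).frequently
  obtain ⟨q, -, φ, hφ, hq⟩ := (isCompact_closedBall p (1 : ℝ)).tendsto_subseq' hball
  obtain ⟨y, rfl, hy⟩ := hv.exists_isIntegralCurve τ q
  have hlim (t : ℝ) : Tendsto (fun n => u (φ n) t) atTop (𝓝 (y t)) := by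
    refine tendsto_iff_dist_tendsto_zero.2 <| squeeze_zero (fun _ => dist_nonneg)
      (fun n => dist_le_mul_exp_abs_of_isIntegralCurve hv.lipschitz (hu (φ n)) hy τ t) ?_
    simpa using (tendsto_iff_dist_tendsto_zero.1 hq).mul_const (Real.exp (L * |t - τ|))
  refine ⟨y, hy, Metric.tendsto_nhds.2 fun ε hε => ?_⟩
  obtain ⟨σ, hσ⟩ := hnear (ε / 2) (half_pos hε)
  filter_upwards [eventually_le_atBot σ] with t ht
  refine (le_of_tendsto ((hlim t).dist tendsto_const_nhds) ?_).trans_lt (half_lt_self hε)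
  filter_upwards [hφ.tendsto_atTop.eventually (hle t)] with n hn
  exact hσ _ _ (hu _) (hup _) t ⟨hn, ht⟩

end AsymptoticallyAutonomous

section Localization

variable {E : Type*} [NormedAddCommGroup E] [NormedSpace ℝ E] {v w : ℝ → E → E} {g g₀ : E → E}
  {K : NNReal} {U N : Set E} {p : E} {y z : ℝ → E}

lemma eqOn_Icc_of_isIntegralCurve (hv : ∀ t, LipschitzWith K (v t)) (hN : IsOpen N)
    (hvw : ∀ t, EqOn (v t) (w t) N) (hy : IsIntegralCurve y v) {a b : ℝ}
    (hzc : ContinuousOn z (Icc a b))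
    (hz : ∀ t ∈ Ico a b, HasDerivWithinAt z (w t (z t)) (Ici t) t) (hza : z a = y a)
    (hyN : ∀ t ∈ Ico a b, z t = y t → y t ∈ N) : EqOn z y (Icc a b) := by
  have hclosed : IsClosed ({t | z t = y t} ∩ Icc a b) := by
    rw [inter_comm]
    exact isClosed_Icc.isClosed_eq hzc hy.continuous.continuousOn
  refine hclosed.Icc_subset_of_forall_mem_nhdsWithin hza fun t ⟨hzy, ht⟩ => ?_
  have hzN : ∀ᶠ s in 𝓝[≥] t, z s ∈ N :=
    (hz t ht).continuousWithinAt.eventually (hN.mem_nhds (hzy ▸ hyN t ht hzy))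
  obtain ⟨c, hc, hcN⟩ := mem_nhdsGE_iff_exists_Icc_subset.1
    (hzN.and (mem_nhdsWithin_of_mem_nhds (Iio_mem_nhds ht.2)))
  have heq : EqOn z y (Icc t c) :=
    ODE_solution_unique hv (hzc.mono (Icc_subset_Icc ht.1 (hcN ⟨le_of_lt hc, le_rfl⟩).2.le))
      (fun s hs => by
        obtain ⟨hsN, hsb⟩ := hcN (Ico_subset_Icc_self hs)
        rw [hvw s hsN]
        exact hz s ⟨ht.1.trans hs.1, hsb⟩)
      hy.continuous.continuousOn (fun s _ => (hy s).hasDerivWithinAt) hzy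
  filter_upwards [Ioc_mem_nhdsGT hc] with s hs using heq (Ioc_subset_Icc_self hs)

lemma IsForwardSolution.eqOn_isIntegralCurve (hz : IsForwardSolution g₀ U z)
    (hg : LipschitzWith K g) (hN : IsOpen N) (hgN : EqOn g g₀ N)
    (hy : IsIntegralCurve y fun _ => g) (hz0 : z 0 = y 0)
    (hyN : ∀ t, 0 ≤ t → z t = y t → y t ∈ N) : EqOn z y (Ici 0) := fun t ht =>
  eqOn_Icc_of_isIntegralCurve (b := t) (fun _ => hg) hN (fun _ => hgN) hy
    (fun s hs => ((hz s hs.1).2.continuousWithinAt).mono Icc_subset_Ici_self)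
    (fun s hs => (hz s hs.1).2.mono (Ici_subset_Ici.2 hs.1)) hz0
    (fun s hs => hyN s hs.1) ⟨ht, le_rfl⟩

lemma tendsto_of_forall_mem_basin (hg : LipschitzWith K g) (hN : IsOpen N) (hgN : EqOn g g₀ N)
    (hy : IsIntegralCurve y fun _ => g) (hy0 : y 0 ∈ basin g₀ U p)
    (hyN : ∀ t, 0 ≤ t → y t ∈ N) : Tendsto y atTop (𝓝 p) := by
  obtain ⟨z, hz0, hz, hzp⟩ := hy0
  have heq := hz.eqOn_isIntegralCurve hg hN hgN hy hz0 fun t ht _ => hyN t ht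
  exact hzp.congr' (eventually_ge_atTop 0 |>.mono heq)

lemma IsAttractingEquilibrium.exists_forall_dist_lt (hp : IsAttractingEquilibrium g₀ U p)
    (hg : LipschitzWith K g) (hN : IsOpen N) (hpN : p ∈ N) (hgN : EqOn g g₀ N) {ε : ℝ}
    (hε : 0 < ε) : ∃ δ > 0, ∀ y : ℝ → E, IsIntegralCurve y (fun _ => g) → dist (y 0) p < δ →
      (∀ t, 0 ≤ t → dist (y t) p < ε) ∧ Tendsto y atTop (𝓝 p) := by
  obtain ⟨ρ, hρ, hρN⟩ := Metric.mem_nhds_iff.1 (hN.mem_nhds hpN)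
  obtain ⟨δ₁, hδ₁, hstab⟩ := hp.stable (min ε ρ) (lt_min hε hρ)
  obtain ⟨δ₂, hδ₂, hbasin⟩ := Metric.mem_nhds_iff.1 hp.attracting
  refine ⟨min δ₁ δ₂, lt_min hδ₁ hδ₂, fun y hy h0 => ?_⟩
  obtain ⟨z, hz0, hz, hzp⟩ := hbasin (Metric.mem_ball.2 (h0.trans_le (min_le_right _ _)))
  have hzρ := hstab z hz (hz0.symm ▸ h0.trans_le (min_le_left _ _))
  have heq := hz.eqOn_isIntegralCurve hg hN hgN hy hz0
    fun t ht hzy => hzy ▸ hρN ((hzρ t ht).trans_le (min_le_right _ _))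
  exact ⟨fun t ht => heq ht ▸ (hzρ t ht).trans_le (min_le_left _ _),
    hzp.congr' (eventually_ge_atTop 0 |>.mono heq)⟩

lemma IsAttractingEquilibrium.isLyapunovStable (hp : IsAttractingEquilibrium g₀ U p)
    (hg : LipschitzWith K g) (hN : IsOpen N) (hpN : p ∈ N) (hgN : EqOn g g₀ N) :
    IsLyapunovStable g p := fun _ hε =>
  (hp.exists_forall_dist_lt hg hN hpN hgN hε).imp fun _ hδ =>
    ⟨hδ.1, fun y hy h0 => (hδ.2 y hy h0).1⟩

lemma IsAttractingEquilibrium.isAsymptoticallyStable [ProperSpace E]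
    (hp : IsAttractingEquilibrium g₀ U p) (hg : IsBoundedLipschitzField (fun _ => g) K)
    (hN : IsOpen N) (hpN : p ∈ N) (hgN : EqOn g g₀ N) : IsAsymptoticallyStable g p := by
  have hstab := hp.isLyapunovStable (hg.lipschitz 0) hN hpN hgN
  obtain ⟨δ, hδ, hconv⟩ := hp.exists_forall_dist_lt (hg.lipschitz 0) hN hpN hgN one_pos
  exact ⟨hstab, Metric.closedBall p (δ / 2), Metric.closedBall_mem_nhds p (half_pos hδ),
    hstab.attractsUniformly_of_isCompact hg (isCompact_closedBall p (δ / 2))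
      fun y hy h0 => (hconv y hy ((Metric.mem_closedBall.1 h0).trans_lt (half_lt_self hδ))).2⟩

end Localization

section Cutoff

lemma exists_contDiff_hasCompactSupport_eventuallyEq {G F : Type*} [NormedAddCommGroup G]
    [NormedSpace ℝ G] [FiniteDimensional ℝ G] [NormedAddCommGroup F] [NormedSpace ℝ F] {n : ℕ∞}
    {φ : G → F} {W Q : Set G} (hW : IsOpen W) (hφ : ContDiffOn ℝ n φ W) (hQ : IsCompact Q)
    (hQW : Q ⊆ W) :
    ∃ ψ : G → F, ContDiff ℝ n ψ ∧ HasCompactSupport ψ ∧ ∀ᶠ x in 𝓝ˢ Q, ψ x = φ x := by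
  obtain ⟨M, hM, hQM, hMW⟩ := exists_compact_between hQ hW hQW
  obtain ⟨χ, hχ1, hχ0, -⟩ := exists_contMDiffMap_one_nhds_of_subset_interior
    (modelWithCornersSelf ℝ G) (n := n) hQ.isClosed hQM
  have hsupp : tsupport (fun x => χ x • φ x) ⊆ M :=
    closure_minimal (fun x hx => by_contra fun hxM => hx (by simp [hχ0 x hxM])) hM.isClosed
  refine ⟨fun x => χ x • φ x, contDiff_iff_contDiffAt.2 fun x => ?_,
    hM.of_isClosed_subset (isClosed_tsupport _) hsupp, ?_⟩
  · by_cases hx : x ∈ W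
    · exact χ.contMDiff.contDiff.contDiffAt.smul (hφ.contDiffAt (hW.mem_nhds hx))
    · exact contDiffAt_const.congr_of_eventuallyEq
        (notMem_tsupport_iff_eventuallyEq.1 fun h => hx (hMW (hsupp h)))
  · filter_upwards [hχ1] with x hx
    simp only [hx, one_smul]

variable {E : Type*} [NormedAddCommGroup E] {f h : E → ℝ → E} {I : Set ℝ} {N : Set E} {L : NNReal}

/-- `h` is a bounded, globally Lipschitz vector field with parameter that coincides with `f` on `N`
for the parameters in `I`. -/
structure IsGlobalization (f h : E → ℝ → E) (N : Set E) (I : Set ℝ) (L : NNReal) : Prop where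
  lipschitz : LipschitzWith L (Function.uncurry h)
  bounded : ∃ C : NNReal, ∀ x l, ‖h x l‖ ≤ C
  eqOn : ∀ l ∈ I, EqOn (fun x => h x l) (fun x => f x l) N

lemma exists_isGlobalization [NormedSpace ℝ E] [FiniteDimensional ℝ E] {U P : Set E} (hU : IsOpen U)
    (hf : ContDiffOn ℝ 1 (Function.uncurry f) (U ×ˢ univ)) (hP : IsCompact P) (hPU : P ⊆ U)
    (hI : IsCompact I) :
    ∃ N, IsOpen N ∧ P ⊆ N ∧ N ⊆ U ∧ ∃ h L, IsGlobalization f h N I L := by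
  have hW : IsOpen (U ×ˢ (univ : Set ℝ)) := hU.prod isOpen_univ
  obtain ⟨ψ, hψ, hψs, hψf⟩ := exists_contDiff_hasCompactSupport_eventuallyEq (n := 1) hW
    (mod_cast hf) (hP.prod hI) (prod_mono hPU (subset_univ I))
  obtain ⟨O, hO, hPO, hOψ⟩ := mem_nhdsSet_iff_exists.1 hψf
  obtain ⟨N, J, hN, -, hPN, hIJ, hNJ⟩ := generalized_tube_lemma hP hI hO hPO
  obtain ⟨L, hL⟩ := hψ.lipschitzWith_of_hasCompactSupport hψs one_ne_zero
  obtain ⟨C, hC⟩ := hψs.exists_bound_of_continuous hψ.continuous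
  exact ⟨N ∩ U, hN.inter hU, subset_inter hPN hPU, inter_subset_right, Function.curry ψ, L,
    { lipschitz := by simpa only [Function.uncurry_curry] using hL
      bounded := ⟨C.toNNReal, fun x l => (hC (x, l)).trans (Real.le_coe_toNNReal C)⟩
      eqOn := fun l hl x hx => hOψ (hNJ ⟨hx.1, hIJ hl⟩) }⟩

lemma IsGlobalization.isBoundedLipschitzField (hh : IsGlobalization f h N I L) {μ : ℝ → ℝ}
    (hμ : Continuous μ) : IsBoundedLipschitzField (fun t x => h x (μ t)) L where
  lipschitz t := by
    simpa [Function.comp_def] using hh.lipschitz.comp (LipschitzWith.prodMk_right (μ t))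
  continuous x := hh.lipschitz.continuous.comp (continuous_const.prodMk hμ)
  bounded := hh.bounded.imp fun _ hC t x => hC x (μ t)

lemma IsGlobalization.tendstoUniformly (hh : IsGlobalization f h N I L) {α : Type*} {ℓ : Filter α}
    {μ : α → ℝ} {l : ℝ} (hμ : Tendsto μ ℓ (𝓝 l)) :
    TendstoUniformly (fun t x => h x (μ t)) (fun x => h x l) ℓ := by
  refine Metric.tendstoUniformly_iff.2 fun ε hε => ?_
  have hdist : Tendsto (fun t => L * dist l (μ t)) ℓ (𝓝 0) := by
    simpa using ((tendsto_const_nhds (x := l)).dist hμ).const_mul (L : ℝ)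
  filter_upwards [hdist.eventually_lt_const hε] with t ht x
  exact (hh.lipschitz.dist_le_mul (x, l) (x, μ t)).trans_lt (by simpa [Prod.dist_eq] using ht)

end Cutoff

section Pullback

variable {E : Type*} [NormedAddCommGroup E] [NormedSpace ℝ E] {f : E → ℝ → E} {Λ : ℝ → ℝ} {r : ℝ}
  {w : ℝ → E → E} {wm wp : E → E} {U : Set E} {C : ℝ → Set E} {p q : E} {b : EReal} {x y : ℝ → E}

/-- A bounded Lipschitz field `v` on the whole space that coincides on an open set `N ⊆ U` with the
field `w`, together with its limits `vm`, `vp` at `∓∞`, which coincide on `N` with `wm` and `wp`.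
The family `C` is inflowing for `v` and stays, up to closure, in `N`, so that integral curves of `v`
in `C` solve the original equation. -/
structure TubeExtension (w : ℝ → E → E) (wm wp : E → E) (U : Set E) (C : ℝ → Set E) where
  v : ℝ → E → E
  vm : E → E
  vp : E → E
  N : Set E
  K : NNReal
  isOpen : IsOpen N
  subset : N ⊆ U
  closure_subset : closure (⋃ t, C t) ⊆ N
  field : IsBoundedLipschitzField v K
  field_bot : IsBoundedLipschitzField (fun _ => vm) K
  field_top : IsBoundedLipschitzField (fun _ => vp) K
  tendsto_bot : TendstoUniformly v vm atBot
  tendsto_top : TendstoUniformly v vp atTop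
  eqOn : ∀ t, EqOn (v t) (w t) N
  eqOn_bot : EqOn vm wm N
  eqOn_top : EqOn vp wp N
  inflowing : IsInflowingFamily v C

namespace TubeExtension

lemma iUnion_subset (h : TubeExtension w wm wp U C) : ⋃ t, C t ⊆ h.N :=
  subset_closure.trans h.closure_subset

lemma mem_of_mem_interior_iInter (h : TubeExtension w wm wp U C) (hp : p ∈ interior (⋂ t, C t)) :
    p ∈ h.N :=
  h.iUnion_subset (mem_iUnion.2 ⟨0, mem_iInter.1 (interior_subset hp) 0⟩)

variable [ProperSpace E]

lemma mem_iUnion_of_tendsto_atBot (h : TubeExtension w wm wp U C) (hp : p ∈ interior (⋂ t, C t))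
    (hy : IsIntegralCurve y h.v) (hyp : Tendsto y atBot (𝓝 p)) (t : ℝ) : y t ∈ ⋃ t, C t :=
  mem_iUnion.2 ⟨t, h.inflowing.mem_of_tendsto_atBot h.field.lipschitz hy hp hyp t⟩

lemma isPullbackSolution_top (h : TubeExtension (fun t x => f x (Λ (r * t))) wm wp U C)
    (hp : p ∈ interior (⋂ t, C t)) (hy : IsIntegralCurve y h.v) (hyp : Tendsto y atBot (𝓝 p)) :
    IsPullbackSolution f U Λ r p ⊤ y where
  bot_lt := bot_lt_top
  solution t _ := by
    have hyN := h.iUnion_subset (h.mem_iUnion_of_tendsto_atBot hp hy hyp t)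
    exact ⟨h.subset hyN, h.eqOn t hyN ▸ hy t⟩
  tendsto_atBot := hyp

lemma tendsto_of_mem_closure_iUnion (h : TubeExtension w wm wp U C)
    (hq : closure (⋃ t, C t) ⊆ basin wp U q) (hy : IsIntegralCurve y fun _ => h.vp)
    (hy0 : y 0 ∈ closure (⋃ t, C t)) : Tendsto y atTop (𝓝 q) :=
  tendsto_of_forall_mem_basin (h.field_top.lipschitz 0) h.isOpen h.eqOn_top hy (hq hy0)
    fun _ ht => h.closure_subset <|
      h.inflowing.mem_closure_iUnion h.field (h.field_top.lipschitz 0) h.tendsto_top hy hy0 ht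

lemma mem_of_closure_iUnion_subset_basin (h : TubeExtension w wm wp U C)
    (hq : closure (⋃ t, C t) ⊆ basin wp U q) (hne : (closure (⋃ t, C t)).Nonempty) : q ∈ h.N := by
  obtain ⟨x₀, hx₀⟩ := hne
  obtain ⟨y, rfl, hy⟩ := h.field_top.exists_isIntegralCurve 0 x₀
  refine h.closure_subset <| isClosed_closure.mem_of_tendsto
    (h.tendsto_of_mem_closure_iUnion hq hy hx₀) ?_
  filter_upwards [eventually_ge_atTop 0] with t ht
  exact h.inflowing.mem_closure_iUnion h.field (h.field_top.lipschitz 0) h.tendsto_top hy hx₀ ht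

lemma tendsto_atTop (h : TubeExtension w wm wp U C) (hqs : IsAttractingEquilibrium wp U q)
    (hC : IsCompact (closure (⋃ t, C t))) (hq : closure (⋃ t, C t) ⊆ basin wp U q)
    (hy : IsIntegralCurve y h.v) (hyC : ∀ t, y t ∈ ⋃ t, C t) : Tendsto y atTop (𝓝 q) := by
  have hqN : q ∈ h.N := h.mem_of_closure_iUnion_subset_basin hq ⟨_, subset_closure (hyC 0)⟩
  have hstab : IsLyapunovStable h.vp q :=
    hqs.isLyapunovStable (h.field_top.lipschitz 0) h.isOpen hqN h.eqOn_top
  have hattr : AttractsUniformly h.vp q (closure (⋃ t, C t)) :=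
    hstab.attractsUniformly_of_isCompact h.field_top hC fun _ hz hz0 =>
      h.tendsto_of_mem_closure_iUnion hq hz hz0
  exact hattr.tendsto_of_tendstoUniformly h.field_top h.tendsto_top hy
    (.of_forall fun t => subset_closure (hyC t))

lemma exists_isPullbackAttractor (h : TubeExtension (fun t x => f x (Λ (r * t))) wm wp U C)
    (hp : p ∈ interior (⋂ t, C t)) (hps : IsAttractingEquilibrium wm U p) :
    ∃ x : ℝ → E, IsPullbackAttractor f U Λ r p ⊤ x := by
  have hpN : p ∈ h.N := h.mem_of_mem_interior_iInter hp
  have hstab : IsAsymptoticallyStable h.vm p :=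
    hps.isAsymptoticallyStable h.field_bot h.isOpen hpN h.eqOn_bot
  obtain ⟨y, hy, hyp⟩ :=
    hstab.exists_isIntegralCurve_tendsto_atBot h.field_bot h.field h.tendsto_bot
  exact ⟨y, h.isPullbackSolution_top hp hy hyp, fun _ _ _ _ => le_top⟩

end TubeExtension

lemma IsPullbackSolution.eqOn_Icc (hx : IsPullbackSolution f U Λ r p b x)
    (h : TubeExtension (fun t x => f x (Λ (r * t))) wm wp U C) (hy : IsIntegralCurve y h.v)
    {s t : ℝ} (ht : (t : EReal) < b) (hxy : x s = y s)
    (hN : ∀ u ∈ Ico s t, x u = y u → y u ∈ h.N) : EqOn x y (Icc s t) := by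
  have hb {u : ℝ} (hu : u ≤ t) : (u : EReal) < b := (EReal.coe_le_coe_iff.2 hu).trans_lt ht
  exact eqOn_Icc_of_isIntegralCurve h.field.lipschitz h.isOpen h.eqOn hy
    (fun u hu => (hx.solution u (hb hu.2)).2.continuousAt.continuousWithinAt)
    (fun u hu => (hx.solution u (hb hu.2.le)).2.hasDerivWithinAt) hxy hN

variable [ProperSpace E]

lemma IsPullbackSolution.exists_eqOn_Iic (hx : IsPullbackSolution f U Λ r p b x)
    (h : TubeExtension (fun t x => f x (Λ (r * t))) wm wp U C) (hp : p ∈ h.N) :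
    ∃ y c, IsIntegralCurve y h.v ∧ EqOn x y (Iic c) := by
  obtain ⟨β, -, hβ⟩ := EReal.lt_iff_exists_real_btwn.1 hx.bot_lt
  obtain ⟨c, hc⟩ := eventually_atBot.1
    ((hx.tendsto_atBot.eventually (h.isOpen.mem_nhds hp)).and (eventually_le_atBot β))
  have hcb : (c : EReal) < b := (EReal.coe_le_coe_iff.2 (hc c le_rfl).2).trans_lt hβ
  obtain ⟨y, hyc, hy⟩ := h.field.exists_isIntegralCurve c (x c)
  refine ⟨y, c, hy, fun t (ht : t ≤ c) => ?_⟩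
  obtain ⟨z, hzt, hz⟩ := h.field.exists_isIntegralCurve t (x t)
  have hxz : x c = z c := hx.eqOn_Icc h hz hcb hzt.symm
    (fun u hu hxz => hxz ▸ (hc u hu.2.le).1) ⟨ht, le_rfl⟩
  rw [eq_of_isIntegralCurve_of_eq h.field.lipschitz hy hz (hyc.trans hxz), hzt]

lemma IsPullbackSolution.exists_isIntegralCurve (hx : IsPullbackSolution f U Λ r p b x)
    (h : TubeExtension (fun t x => f x (Λ (r * t))) wm wp U C) (hp : p ∈ interior (⋂ t, C t)) :
    ∃ y, IsIntegralCurve y h.v ∧ Tendsto y atBot (𝓝 p) ∧ ∀ t : ℝ, (t : EReal) < b → x t = y t := by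
  obtain ⟨y, c, hy, hxy⟩ := hx.exists_eqOn_Iic h (h.mem_of_mem_interior_iInter hp)
  have hyp : Tendsto y atBot (𝓝 p) := hx.tendsto_atBot.congr' (eventually_le_atBot c |>.mono hxy)
  refine ⟨y, hy, hyp, fun t ht => ?_⟩
  rcases le_total t c with htc | hct
  · exact hxy htc
  · exact hx.eqOn_Icc h hy ht (hxy (mem_Iic.2 le_rfl))
      (fun u _ _ => h.iUnion_subset (h.mem_iUnion_of_tendsto_atBot hp hy hyp u)) ⟨hct, le_rfl⟩

lemma IsPullbackAttractor.eq_top_and_isIntegralCurve (hx : IsPullbackAttractor f U Λ r p b x)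
    (h : TubeExtension (fun t x => f x (Λ (r * t))) wm wp U C) (hp : p ∈ interior (⋂ t, C t)) :
    b = ⊤ ∧ IsIntegralCurve x h.v := by
  obtain ⟨y, hy, hyp, hxy⟩ := hx.toIsPullbackSolution.exists_isIntegralCurve h hp
  obtain rfl : b = ⊤ := top_le_iff.1 <|
    hx.maximal ⊤ y (h.isPullbackSolution_top hp hy hyp) fun t ht _ => (hxy t ht).symm
  obtain rfl : x = y := funext fun t => hxy t (EReal.coe_lt_top t)
  exact ⟨rfl, hy⟩

lemma IsPullbackAttractor.endpointTracks (hx : IsPullbackAttractor f U Λ r p b x)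
    (h : TubeExtension (fun t x => f x (Λ (r * t))) wm wp U C) (hp : p ∈ interior (⋂ t, C t))
    (hqs : IsAttractingEquilibrium wp U q) (hC : IsCompact (closure (⋃ t, C t)))
    (hq : closure (⋃ t, C t) ⊆ basin wp U q) : EndpointTracks q b x := by
  obtain ⟨hb, hxv⟩ := hx.eq_top_and_isIntegralCurve h hp
  exact ⟨hb, h.tendsto_atTop hqs hC hq hxv (h.mem_iUnion_of_tendsto_atBot hp hxv hx.tendsto_atBot)⟩

end Pullback

section Hurwitz

open Polynomial

section DampedEquation

variable {V : Type*} [NormedAddCommGroup V] [NormedSpace ℝ V] [NormedSpace ℂ V]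
  [IsScalarTower ℝ ℂ V] {μ : ℂ} {u w : ℝ → V}

lemma hasDerivAt_exp_neg_mul_smul {t : ℝ} (hu : HasDerivAt u (μ • u t + w t) t) :
    HasDerivAt (fun t : ℝ => Complex.exp (-μ * t) • u t) (Complex.exp (-μ * t) • w t) t := by
  refine (((hasDerivAt_id t).ofReal_comp.const_mul (-μ)).cexp.fun_smul hu).congr_deriv ?_
  simp only [id, Complex.ofReal_one]
  module

lemma norm_cexp_neg_mul (μ : ℂ) (t : ℝ) : ‖Complex.exp (-μ * t)‖ = Real.exp (-μ.re * t) := by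
  simp [Complex.norm_exp]

lemma norm_le_of_hasDerivAt_smul_add (hu : ∀ t, HasDerivAt u (μ • u t + w t) t) {s t δ : ℝ}
    (hst : s ≤ t) (hw : ∀ τ, s ≤ τ → ‖w τ‖ ≤ -μ.re * δ) :
    ‖u t‖ * Real.exp (-μ.re * t) ≤
      ‖u s‖ * Real.exp (-μ.re * s) + δ * (Real.exp (-μ.re * t) - Real.exp (-μ.re * s)) := by
  have hz (t : ℝ) := hasDerivAt_exp_neg_mul_smul (hu t)
  have hnorm (t : ℝ) : ‖Complex.exp (-μ * t) • u t‖ = ‖u t‖ * Real.exp (-μ.re * t) := by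
    rw [norm_smul, norm_cexp_neg_mul, mul_comm]
  rw [← hnorm t, ← hnorm s]
  refine image_norm_le_of_norm_deriv_right_le_deriv_boundary
    (B := fun t => ‖Complex.exp (-μ * s) • u s‖
      + δ * (Real.exp (-μ.re * t) - Real.exp (-μ.re * s)))
    (B' := fun t => Real.exp (-μ.re * t) * (-μ.re * δ))
    (fun t _ => (hz t).continuousAt.continuousWithinAt) (fun t _ => (hz t).hasDerivWithinAt)
    (by simp) (fun t => ?_) (fun t ht => ?_) ⟨hst, le_rfl⟩
  · refine (((((hasDerivAt_id t).const_mul (-μ.re)).exp.sub_const _).const_mul δ).const_add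
      _).congr_deriv ?_
    simp only [id]
    ring
  · rw [norm_smul, norm_cexp_neg_mul]
    gcongr
    exact hw t ht.1

lemma tendsto_zero_of_hasDerivAt_smul_add (hμ : μ.re < 0)
    (hu : ∀ t, HasDerivAt u (μ • u t + w t) t) (hw : Tendsto w atTop (𝓝 0)) :
    Tendsto u atTop (𝓝 0) := by
  have hμ' : 0 < -μ.re := neg_pos.2 hμ
  refine Metric.tendsto_nhds.2 fun ε hε => ?_
  obtain ⟨s, hs⟩ :=
    eventually_atTop.1 (Metric.tendsto_nhds.1 hw (-μ.re * (ε / 2)) (by positivity))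
  have hdecay : Tendsto (fun t => ‖u s‖ * Real.exp (-μ.re * s) / Real.exp (-μ.re * t)) atTop
      (𝓝 0) :=
    (Real.tendsto_exp_atTop.comp (tendsto_id.const_mul_atTop hμ')).const_div_atTop _
  filter_upwards [eventually_ge_atTop s, hdecay.eventually_lt_const (half_pos hε)] with t ht hlt
  have hfence := norm_le_of_hasDerivAt_smul_add hu ht
    (fun τ hτ => by simpa only [dist_zero_right] using (hs τ hτ).le)
  rw [div_lt_iff₀ (Real.exp_pos _)] at hlt
  rw [dist_zero_right, ← mul_lt_mul_iff_left₀ (Real.exp_pos (-μ.re * t))]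
  linarith [mul_pos (half_pos hε) (Real.exp_pos (-μ.re * s))]

lemma tendsto_zero_of_aeval_prod_eq_zero {B : V →L[ℂ] V} {s : Multiset ℂ}
    (hs : ∀ μ ∈ s, μ.re < 0) (hu : ∀ t, HasDerivAt u (B (u t)) t)
    (h0 : ∀ t, aeval B (s.map fun μ => X - C μ).prod (u t) = 0) : Tendsto u atTop (𝓝 0) := by
  induction s using Multiset.induction_on generalizing u with
  | empty =>
    obtain rfl : u = 0 := funext fun t => by simpa using h0 t
    exact tendsto_const_nhds
  | cons μ s ih =>
    have hBμ (t : ℝ) : HasDerivAt (fun t => B (u t) - μ • u t) (B (B (u t) - μ • u t)) t := by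
      rw [map_sub, map_smul]
      exact ((B.restrictScalars ℝ).hasFDerivAt.comp_hasDerivAt t (hu t)).sub ((hu t).const_smul μ)
    have hw := ih (fun ν hν => hs ν (Multiset.mem_cons_of_mem hν)) hBμ fun t => by
      have := h0 t
      rw [Multiset.map_cons, Multiset.prod_cons, mul_comm, map_mul] at this
      simpa [Algebra.algebraMap_eq_smul_one] using this
    exact tendsto_zero_of_hasDerivAt_smul_add (hs μ (Multiset.mem_cons_self μ s))
      (fun t => by simpa using hu t) hw

end DampedEquation

variable {E : Type*} [NormedAddCommGroup E] [NormedSpace ℝ E]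

/-- `φ ↦ φ ∘ A`, as a `ℂ`-linear operator on the `ℝ`-linear maps into a complex space. -/
def precompComplex {F : Type*} [NormedAddCommGroup F] [NormedSpace ℝ F] [NormedSpace ℂ F]
    [IsScalarTower ℝ ℂ F] (A : E →L[ℝ] E) : (E →L[ℝ] F) →L[ℂ] E →L[ℝ] F where
  toFun φ := φ ∘L A
  map_add' φ ψ := φ.add_comp ψ A
  map_smul' c φ := φ.smul_comp c A
  cont := by fun_prop

lemma aeval_precompComplex {F : Type*} [NormedAddCommGroup F] [NormedSpace ℝ F]
    [NormedSpace ℂ F] [IsScalarTower ℝ ℂ F] (A : E →L[ℝ] E) (q : ℝ[X]) (φ : E →L[ℝ] F) :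
    aeval (precompComplex A) q φ = φ ∘L aeval A q := by
  induction q using Polynomial.induction_on generalizing φ with
  | C a => ext x; simp [Algebra.algebraMap_eq_smul_one]
  | add p q hp hq => simp only [map_add, add_apply, hp, hq, φ.comp_add]
  | monomial n a ih =>
    rw [pow_succ, ← mul_assoc, map_mul, aeval_X, mul_apply_eq_comp, ih, mul_comm _ X,
      map_mul _ X, aeval_X]
    rfl

variable [FiniteDimensional ℝ E] {A : E →L[ℝ] E}

/-- All complex roots of the characteristic polynomial of `A` have negative real part. -/
def IsHurwitz (A : E →L[ℝ] E) : Prop :=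
  ∀ μ : ℂ, aeval μ (LinearMap.charpoly (A : E →ₗ[ℝ] E)) = 0 → μ.re < 0

lemma aeval_charpoly_self (A : E →L[ℝ] E) :
    aeval A (LinearMap.charpoly (A : E →ₗ[ℝ] E)) = 0 := by
  have := aeval_algHom_apply (Module.End.toContinuousLinearMap E).toAlgHom (A : E →ₗ[ℝ] E)
    (LinearMap.charpoly (A : E →ₗ[ℝ] E))
  rw [LinearMap.aeval_self_charpoly, map_zero] at this
  exact this

lemma IsHurwitz.tendsto_exp (hA : IsHurwitz A) :
    Tendsto (fun t : ℝ => NormedSpace.exp (t • A)) atTop (𝓝 0) := by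
  set q := (LinearMap.charpoly (A : E →ₗ[ℝ] E)).map (algebraMap ℝ ℂ) with hq
  have hqprod : (q.roots.map fun μ => X - C μ).prod = q :=
    ((IsAlgClosed.splits q).eq_prod_roots_of_monic
      ((LinearMap.charpoly_monic _).map _)).symm
  have hcomplex {F : Type} [NormedAddCommGroup F] [NormedSpace ℝ F] [NormedSpace ℂ F]
      [IsScalarTower ℝ ℂ F] (φ : E →L[ℝ] F) :
      Tendsto (fun t : ℝ => φ ∘L NormedSpace.exp (t • A)) atTop (𝓝 0) := by
    refine tendsto_zero_of_aeval_prod_eq_zero (B := precompComplex A) (s := q.roots) ?_ ?_ ?_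
    · intro μ hμ
      exact hA μ (by simpa [hq, eval_map_algebraMap] using (mem_roots'.1 hμ).2)
    · intro t
      exact (ContinuousLinearMap.compL ℝ E E F φ).hasFDerivAt.comp_hasDerivAt t
        (hasDerivAt_exp_smul_const A t)
    · intro t
      rw [hqprod, hq, aeval_map_algebraMap, aeval_precompComplex, aeval_charpoly_self,
        ContinuousLinearMap.comp_zero]
  let e := (Module.finBasis ℝ E).equivFunL
  let φ : E →L[ℝ] Fin (Module.finrank ℝ E) → ℂ :=
    (ContinuousLinearMap.pi fun i => Complex.ofRealCLM ∘L .proj i) ∘L (e : E →L[ℝ] _)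
  let ψ : (Fin (Module.finrank ℝ E) → ℂ) →L[ℝ] E :=
    (e.symm : _ →L[ℝ] E) ∘L (.pi fun i => Complex.reCLM ∘L .proj i)
  have hψφ : ψ ∘L φ = .id ℝ E := by ext x; simp [φ, ψ]
  have := ((ContinuousLinearMap.compL ℝ E _ E ψ).continuous.tendsto 0).comp (hcomplex φ)
  simpa [Function.comp_def, ← ContinuousLinearMap.comp_assoc, hψφ] using this

lemma IsHurwitz.exists_forall_eq_zero (hA : IsHurwitz A) :
    ∃ η > 0, ∀ {w w' : ℝ → E} {S M : ℝ}, (∀ t ≤ S, HasDerivAt w (w' t) t) →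
      (∀ t ≤ S, ‖w' t - A (w t)‖ ≤ η * ‖w t‖) → (∀ t ≤ S, ‖w t‖ ≤ M) → ∀ t ≤ S, w t = 0 := by
  obtain ⟨T, hT, hTA⟩ := ((eventually_ge_atTop 0).and
    (Metric.tendsto_nhds.1 hA.tendsto_exp (1 / 4) (by norm_num))).exists
  rw [dist_zero_right] at hTA
  obtain ⟨η, hη, hcomp⟩ := exists_forall_dist_le_mul_of_dist_deriv_le (E := E) ‖A‖₊ hT
    (ε := 1 / 4) (by norm_num)
  refine ⟨η, hη, fun {w w' S M} hw hwA hM => ?_⟩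
  have hhalf {M : ℝ} (hM : ∀ t ≤ S, ‖w t‖ ≤ M) (b : ℝ) (hb : b ≤ S) : ‖w b‖ ≤ M / 2 := by
    have hM0 : 0 ≤ M := (norm_nonneg _).trans (hM b hb)
    let z : ℝ → E := fun t => NormedSpace.exp ((t - (b - T)) • A) (w (b - T))
    have hz : IsIntegralCurve z fun _ => A := fun t =>
      (((hasDerivAt_exp_smul_const' A (t - (b - T))).comp_sub_const t (b - T)).clm_apply
        (hasDerivAt_const t (w (b - T)))).congr_deriv (by simp [z])
    have hz0 : w (b - T) = z (b - T) := by simp [z]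
    have hzb : ‖z b‖ ≤ 1 / 4 * M := by
      simp only [z, sub_sub_cancel]
      exact ContinuousLinearMap.le_of_opNorm_le_of_le _ hTA.le (hM _ (by linarith))
    have hwz : dist (w b) (z b) ≤ 1 / 4 * M :=
      hcomp (a := b - T) (fun _ => A.lipschitz) hM0 ⟨by linarith, by linarith⟩
        (fun t ht => hw t (ht.2.trans hb))
        (fun t ht => by
          rw [dist_eq_norm]
          exact (hwA t (ht.2.trans hb)).trans (by gcongr; exact hM t (ht.2.trans hb)))
        hz (by rw [hz0, dist_self]; positivity)
    rw [dist_eq_norm] at hwz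
    linarith [norm_le_norm_sub_add (w b) (z b)]
  have hpow (n : ℕ) : ∀ t ≤ S, ‖w t‖ ≤ M / 2 ^ n := by
    induction n with
    | zero => simpa using hM
    | succ n ih => simpa [pow_succ, div_div] using hhalf ih
  intro t ht
  have hlim : Tendsto (fun n : ℕ => M / 2 ^ n) atTop (𝓝 0) :=
    (tendsto_pow_atTop_atTop_of_one_lt one_lt_two).const_div_atTop M
  exact norm_le_zero_iff.1 (ge_of_tendsto' hlim fun n => hpow n t ht)

lemma IsPullbackSolution.exists_eq_of_isHurwitz {f : E → ℝ → E} {U : Set E} {Λ : ℝ → ℝ} {p : E}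
    {l r : ℝ} {b b' : EReal} {x y : ℝ → E} (hf : ContDiffAt ℝ 1 (Function.uncurry f) (p, l))
    (hA : IsHurwitz (fderiv ℝ (fun x => f x l) p)) (hΛ : Tendsto (fun t => Λ (r * t)) atBot (𝓝 l))
    (hx : IsPullbackSolution f U Λ r p b x) (hy : IsPullbackSolution f U Λ r p b' y) :
    ∃ t, x t = y t := by
  obtain ⟨η, hη, hzero⟩ := hA.exists_forall_eq_zero
  obtain ⟨β, -, hβ⟩ := EReal.lt_iff_exists_real_btwn.1 (lt_min hx.bot_lt hy.bot_lt)
  have hD := hf.hasStrictFDerivAt one_ne_zero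
  have hAD : fderiv ℝ (fun x => f x l) p =
      fderiv ℝ (Function.uncurry f) (p, l) ∘L .inl ℝ E ℝ :=
    (HasFDerivAt.comp (g := Function.uncurry f) (f := fun x => (x, l)) p hD.hasFDerivAt
      (hasFDerivAt_prodMk_left p l)).fderiv
  have hpair : Tendsto (fun t => ((x t, Λ (r * t)), (y t, Λ (r * t)))) atBot
      (𝓝 ((p, l), (p, l))) :=
    (hx.tendsto_atBot.prodMk_nhds hΛ).prodMk_nhds (hy.tendsto_atBot.prodMk_nhds hΛ)
  have hsub : Tendsto (fun t => ‖x t - y t‖) atBot (𝓝 0) := by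
    simpa using (hx.tendsto_atBot.sub hy.tendsto_atBot).norm
  obtain ⟨S, hS⟩ := eventually_atBot.1
    (((hpair.eventually (hD.isLittleO.def hη)).and (hsub.eventually_le_const one_pos)).and
      (eventually_le_atBot β))
  have hlt {t : ℝ} (ht : t ≤ S) : (t : EReal) < min b b' :=
    (EReal.coe_le_coe_iff.2 (hS t ht).2).trans_lt hβ
  have hzero := hzero (w := fun t => x t - y t)
    (fun t ht => (hx.solution t ((hlt ht).trans_le (min_le_left _ _))).2.fun_sub
      (hy.solution t ((hlt ht).trans_le (min_le_right _ _))).2)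
    (fun t ht => by simpa [hAD, Function.uncurry, Prod.norm_def] using (hS t ht).1.1)
    (fun t ht => (hS t ht).1.2) S le_rfl
  exact ⟨S, sub_eq_zero.1 hzero⟩

end Hurwitz

section ForwardInflowing

variable {E : Type*} [NormedAddCommGroup E] [NormedSpace ℝ E] {f : E → ℝ → E} {Λ : ℝ → ℝ}
  {lm lp : ℝ} {U : Set E} {K : ℝ → Set E} {Xm Xp : E}

lemma eventually_add_smul_mem_of_pointsStrictlyInto {v x : E} {C : Set E} (hC : IsClosed C)
    (hx : x ∈ C) (h : x ∈ frontier C → PointsStrictlyInto v x C) :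
    ∀ᶠ τ in 𝓝[>] (0 : ℝ), x + τ • v ∈ C := by
  by_cases hxi : x ∈ interior C
  · have hc : Tendsto (fun τ : ℝ => x + τ • v) (𝓝[>] 0) (𝓝 x) := by
      have : Continuous fun τ : ℝ => x + τ • v := by fun_prop
      simpa using (this.tendsto 0).mono_left nhdsWithin_le_nhds
    exact hc.eventually (mem_interior_iff_mem_nhds.1 hxi)
  · obtain ⟨ε, hε, hin⟩ := h (hC.frontier_eq ▸ ⟨hx, hxi⟩)
    filter_upwards [Ioo_mem_nhdsGT hε] with τ hτ
    exact interior_subset (hin τ hτ.1 hτ.2)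

lemma IsForwardInflowingStable.exists_isInflowingFamily {X : ℝ → E}
    (h : IsForwardInflowingStable f U Λ lp X Xm Xp) :
    ∃ K : ℝ → Set E, IsInflowingFamily (fun s x => f x (Λ s)) K ∧ Xm ∈ interior (⋂ s, K s) ∧
      IsCompact (closure (⋃ s, K s)) ∧ closure (⋃ s, K s) ⊆ basin (fun x => f x lp) U Xp := by
  obtain ⟨K, hK, -, hmono, hin, hXm, -, hcomp, hbasin⟩ := h
  refine ⟨K, ⟨fun s => (hK s).isClosed, monotone_iff_forall_lt.2 fun s t => hmono s t,
    fun s x hx => ?_⟩, hXm, hcomp, hbasin⟩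
  exact eventually_add_smul_mem_of_pointsStrictlyInto (hK s).isClosed hx (hin s x)

lemma exists_isCompact_forall_mem_of_tendsto {Y : Type*} [TopologicalSpace Y]
    [WeaklyLocallyCompactSpace Y] {g : ℝ → Y} {a b : Y} (hg : Continuous g)
    (ha : Tendsto g atBot (𝓝 a)) (hb : Tendsto g atTop (𝓝 b)) :
    ∃ I, IsCompact I ∧ a ∈ I ∧ b ∈ I ∧ ∀ t, g t ∈ I := by
  obtain ⟨A, hA, haA⟩ := exists_compact_mem_nhds a
  obtain ⟨B, hB, hbB⟩ := exists_compact_mem_nhds b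
  obtain ⟨s, hs⟩ := eventually_atBot.1 (ha haA)
  obtain ⟨t, ht⟩ := eventually_atTop.1 (hb hbB)
  refine ⟨A ∪ g '' Icc s t ∪ B, (hA.union (isCompact_Icc.image hg)).union hB,
    .inl (.inl (mem_of_mem_nhds haA)), .inr (mem_of_mem_nhds hbB), fun u => ?_⟩
  rcases le_total u s with hus | hsu
  · exact .inl (.inl (hs u hus))
  · rcases le_total u t with hut | htu
    · exact .inl (.inr ⟨u, ⟨hsu, hut⟩, rfl⟩)
    · exact .inr (ht u htu)

lemma IsInflowingFamily.comp_mul {v : ℝ → E → E} (hK : IsInflowingFamily v K) {r : ℝ}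
    (hr : 0 ≤ r) : IsInflowingFamily (fun t => v (r * t)) fun t => K (r * t) where
  isClosed t := hK.isClosed (r * t)
  mono := hK.mono.comp (monotone_id.const_mul hr)
  inward t := hK.inward (r * t)

lemma IsInflowingFamily.congr {v w : ℝ → E → E} (hK : IsInflowingFamily v K)
    (h : ∀ t, EqOn (w t) (v t) (K t)) : IsInflowingFamily w K where
  isClosed := hK.isClosed
  mono := hK.mono
  inward t x hx := (h t hx).symm ▸ hK.inward t x hx

variable [FiniteDimensional ℝ E]

lemma IsInflowingFamily.nonempty_tubeExtension (hK : IsInflowingFamily (fun t x => f x (Λ t)) K)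
    (hU : IsOpen U) (hf : ContDiffOn ℝ 1 (Function.uncurry f) (U ×ˢ univ)) (hΛ : Continuous Λ)
    (hm : Tendsto Λ atBot (𝓝 lm)) (hp : Tendsto Λ atTop (𝓝 lp))
    (hcomp : IsCompact (closure (⋃ t, K t))) (hKU : closure (⋃ t, K t) ⊆ U) :
    Nonempty (TubeExtension (fun t x => f x (Λ t)) (fun x => f x lm) (fun x => f x lp) U K) := by
  obtain ⟨I, hI, hmI, hpI, hΛI⟩ := exists_isCompact_forall_mem_of_tendsto hΛ hm hp
  obtain ⟨N, hN, hKN, hNU, h, L, hh⟩ := exists_isGlobalization hU hf hcomp hKU hI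
  have hKN' (t : ℝ) : K t ⊆ N := (subset_iUnion K t).trans (subset_closure.trans hKN)
  exact ⟨{
    v := fun t x => h x (Λ t)
    vm := fun x => h x lm
    vp := fun x => h x lp
    N := N
    K := L
    isOpen := hN
    subset := hNU
    closure_subset := hKN
    field := hh.isBoundedLipschitzField hΛ
    field_bot := hh.isBoundedLipschitzField continuous_const
    field_top := hh.isBoundedLipschitzField continuous_const
    tendsto_bot := hh.tendstoUniformly hm
    tendsto_top := hh.tendstoUniformly hp
    eqOn := fun t => hh.eqOn _ (hΛI t)
    eqOn_bot := hh.eqOn _ hmI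
    eqOn_top := hh.eqOn _ hpI
    inflowing := hK.congr fun t => (hh.eqOn _ (hΛI t)).mono (hKN' t) }⟩

theorem proposition4p2_general (hU : IsOpen U)
    (hf : ContDiffOn ℝ 1 (Function.uncurry f) (U ×ˢ univ)) (hΛ : Continuous Λ)
    (hm : Tendsto Λ atBot (𝓝 lm)) (hp : Tendsto Λ atTop (𝓝 lp))
    (hXm : IsAttractingEquilibrium (fun x => f x lm) U Xm)
    (hXp : IsAttractingEquilibrium (fun x => f x lp) U Xp)
    (hK : IsInflowingFamily (fun s x => f x (Λ s)) K) (hXmK : Xm ∈ interior (⋂ s, K s))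
    (hcomp : IsCompact (closure (⋃ s, K s)))
    (hbasin : closure (⋃ s, K s) ⊆ basin (fun x => f x lp) U Xp) :
    (∀ r : ℝ, r > 0 →
      (∃ (b : EReal) (x : ℝ → E), IsPullbackAttractor f U Λ r Xm b x) ∧
      (∀ (b : EReal) (x : ℝ → E), IsPullbackAttractor f U Λ r Xm b x → EndpointTracks Xp b x) ∧
      (IsHurwitz (fderiv ℝ (fun x => f x lm) Xm) → ∀ (b b' : EReal) (x x' : ℝ → E),
        IsPullbackAttractor f U Λ r Xm b x → IsPullbackAttractor f U Λ r Xm b' x' → x = x')) ∧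
    ¬ HasRTipping f U Λ Xm Xp := by
  suffices h : ∀ r : ℝ, r > 0 → _ from ⟨h, fun ⟨r, hr, b, x, hx, hn⟩ => hn ((h r hr).2.1 b x hx)⟩
  intro r hr
  have hmr : Tendsto (fun t => Λ (r * t)) atBot (𝓝 lm) := hm.comp (tendsto_id.const_mul_atBot hr)
  have hpr : Tendsto (fun t => Λ (r * t)) atTop (𝓝 lp) := hp.comp (tendsto_id.const_mul_atTop hr)
  have hsurj : Function.Surjective (r * ·) := mul_left_surjective₀ hr.ne'
  rw [← hsurj.iInter_comp] at hXmK
  rw [← hsurj.iUnion_comp] at hcomp hbasin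
  have hKU : closure (⋃ t, K (r * t)) ⊆ U := fun y hy => by
    obtain ⟨z, rfl, hz, -⟩ := hbasin hy
    exact (hz 0 le_rfl).1
  obtain ⟨T⟩ := (hK.comp_mul hr.le).nonempty_tubeExtension hU hf (hΛ.comp (continuous_const_mul r))
    hmr hpr hcomp hKU
  refine ⟨⟨⊤, T.exists_isPullbackAttractor hXmK hXm⟩,
    fun b x hx => hx.endpointTracks T hXmK hXp hcomp hbasin, fun hA b b' x x' hx hx' => ?_⟩
  have hfXm : ContDiffAt ℝ 1 (Function.uncurry f) (Xm, lm) :=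
    hf.contDiffAt (prod_mem_nhds (hU.mem_nhds hXm.mem) univ_mem)
  obtain ⟨t, ht⟩ :=
    hx.toIsPullbackSolution.exists_eq_of_isHurwitz hfXm hA hmr hx'.toIsPullbackSolution
  exact eq_of_isIntegralCurve_of_eq T.field.lipschitz (hx.eq_top_and_isIntegralCurve T hXmK).2
    (hx'.eq_top_and_isIntegralCurve T hXmK).2 ht

end ForwardInflowing

theorem proposition4p2 {n : ℕ} (U : Set (EuclideanSpace ℝ (Fin n))) (hU : IsOpen U)
    (f : EuclideanSpace ℝ (Fin n) → ℝ → EuclideanSpace ℝ (Fin n))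
    (hf : ContDiffOn ℝ 2 (Function.uncurry f) (U ×ˢ univ))
    (Λ : ℝ → ℝ) (lm lp : ℝ) (hΛ : IsParameterShift Λ lm lp)
    (X : ℝ → EuclideanSpace ℝ (Fin n)) (Xm Xp : EuclideanSpace ℝ (Fin n))
    (hX : IsStablePath f U Λ lm lp X Xm Xp)
    (hFIS : IsForwardInflowingStable f U Λ lp X Xm Xp) :
    (∀ r : ℝ, r > 0 →
      (∃ (b : EReal) (x : ℝ → EuclideanSpace ℝ (Fin n)), IsPullbackAttractor f U Λ r Xm b x) ∧
      (∀ (b : EReal) (x : ℝ → EuclideanSpace ℝ (Fin n)),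
        IsPullbackAttractor f U Λ r Xm b x → EndpointTracks Xp b x) ∧
      (IsLinearlyStable (fun x => f x lm) Xm →
        ∀ (b b' : EReal) (x x' : ℝ → EuclideanSpace ℝ (Fin n)),
          IsPullbackAttractor f U Λ r Xm b x → IsPullbackAttractor f U Λ r Xm b' x' → x = x')) ∧
    ¬ HasRTipping f U Λ Xm Xp := by
  obtain ⟨K, hK, hXm, hcomp, hbasin⟩ := hFIS.exists_isInflowingFamily
  exact proposition4p2_general hU (hf.of_le one_le_two) hΛ.contDiff.continuous hΛ.tendsto_atBot
    hΛ.tendsto_atTop hX.attracting_minus hX.attracting_plus hK hXm hcomp hbasin
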